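/- \textbf{Theorem.} Let $0<p\le 2$ and put $s=\tfrac1p-\tfrac12$. There is a constant $C=C(p)<\infty$ such that the following holds. Let $N\in\mathbb N$ with $N>s$, and let $\varphi:\mathbb R\to\mathbb C$ be a compactly supported $C^N$ function whose wavelet system $\varphi_{j,n}(x)=2^{n/2}\varphi(2^nx-j)$, $j,n\in\mathbb Z$, is an orthonormal basis of $L_2(\mathbb R)$. Let $k\in L_2(\mathbb R^2)$, regarded as the $L_2(\mathbb R)$-valued function $x\mapsto k(x,\cdot)$, belong to the homogeneous Besov space $\dot B^{s}_{p,p}(\mathbb R,L_2(\mathbb R))$. Then the integral operator $$(\operatorname{Op}(k)f)(y)=\int_{\mathbb R}k(x,y)f(x)\,dx,\qquad f\in L_2(\mathbb R),$$ belongs to the Schatten class $\mathcal L_p(L_2(\mathbb R))$, and $$\|\operatorname{Op}(k)\|_p\le C\left(\|k\|_{L_2(\mathbb R^2)}+|k|_{\dot B^{s}_{p,p}(\mathbb R,L_2(\mathbb R))}\right).$$ Here, for a bounded operator $T$ on a Hilbert space, $\mu(n,T)=\inf\{\|T-R\|:\operatorname{rank}R\le n\}$ for $n\ge 0$ and $\|T\|_p=\big(\sum_{n\ge0}\mu(n,T)^p\big)^{1/p}$;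 the operator $T$ belongs to $\mathcal L_p$ if it is compact and $\|T\|_p<\infty$. For a complex Banach space $E$, an $E$-valued tempered distribution $f$ belongs to $\dot B^{s}_{p,q}(\mathbb R,E)$ if it can be written as $f=\sum_{j,n\in\mathbb Z}(c_{j,n}\varphi_{j,n}+P_{j,n})$, where $c_{j,n}\in E$, the $P_{j,n}$ are polynomials with coefficients in $E$, the series converges unconditionally in $\mathcal S'(\mathbb R,E)$ (in norm, on each Schwartz function), and $$\Big\|\Big(2^{n(s+\frac12-\frac1p)}\big\|(\|c_{j,n}\|_E)_{j\in\mathbb Z}\big\|_{\ell_p(\mathbb Z)}\Big)_{n\in\mathbb Z}\Big\|_{\ell_q(\mathbb Z)}<\infty ;$$ $|f|_{\dot B^{s}_{p,q}(\mathbb R,E)}$ is the infimum of this quantity over all such representations. For $p=2$ (so $s=0$) the same definition is used. -/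

import Mathlib

open MeasureTheory
open scoped ENNReal NNReal SchwartzMap

noncomputable section

/-! ### Singular values and Schatten classes -/

section Schatten

variable {H : Type*} [NormedAddCommGroup H] [InnerProductSpace ℂ H]

/-- The singular value `μ(n, T) = inf {‖T - R‖ : rank R ≤ n}` of a bounded operator, `n ≥ 0`. -/
def singularValue (n : ℕ) (T : H →L[ℂ] H) : ℝ≥0∞ :=
  ⨅ (R : H →L[ℂ] H) (_ : LinearMap.rank (R : H →ₗ[ℂ] H) ≤ (n : Cardinal)), ‖T - R‖ₑ

/-- The Schatten quasi-norm `‖T‖_p = (∑ₙ μ(n, T) ^ p) ^ (1 / p)`, with values in `[0, ∞]`. -/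
def schattenNorm (p : ℝ) (T : H →L[ℂ] H) : ℝ≥0∞ :=
  (∑' n : ℕ, singularValue n T ^ p) ^ (1 / p)

/-- The Schatten class: compact operators with finite Schatten quasi-norm. -/
def MemSchatten (p : ℝ) (T : H →L[ℂ] H) : Prop :=
  IsCompactOperator T ∧ schattenNorm p T < ∞

end Schatten

/-! ### Wavelets -/

/-- The wavelet system `φ_{j,k}(x) = 2 ^ (k / 2) φ(2 ^ k x - j)`: `j` is the translation index and
`k` the dilation index. -/
def waveletSystem (φ : ℝ → ℂ) (j k : ℤ) (x : ℝ) : ℂ :=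
  (((2 : ℝ) ^ ((k : ℝ) / 2) : ℝ) : ℂ) * φ ((2 : ℝ) ^ k * x - j)

/-- `φ` is an orthonormal wavelet: its wavelet system is an orthonormal basis of `L₂(ℝ)`. -/
def IsOrthonormalWavelet (φ : ℝ → ℂ) : Prop :=
  ∃ b : HilbertBasis (ℤ × ℤ) ℂ (Lp ℂ 2 (volume : Measure ℝ)),
    ∀ j k : ℤ, b (j, k) =ᵐ[volume] waveletSystem φ j k

/-- A compactly supported, `N`-times continuously differentiable orthonormal wavelet. -/
structure IsCompactWavelet (N : ℕ) (φ : ℝ → ℂ) : Prop where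
  contDiff : ContDiff ℝ N φ
  hasCompactSupport : HasCompactSupport φ
  isOrthonormalWavelet : IsOrthonormalWavelet φ

/-! ### Vector-valued homogeneous Besov spaces -/

section Besov

variable {E : Type*} [NormedAddCommGroup E] [NormedSpace ℂ E] [CompleteSpace E]

/-- The polynomial function `x ↦ ∑ₙ xⁿ aₙ` on `ℝ` with coefficients `aₙ ∈ E`. -/
def polyFun (P : ℕ →₀ E) (x : ℝ) : E :=
  P.sum fun n a => ((x : ℂ) ^ n) • a

/-- `f = ∑_{j,k} (c_{j,k} φ_{j,k} + P_{j,k})`, with convergence in `𝓢'(ℝ, E)`, whose topology is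
that of pointwise norm convergence on Schwartz functions. A locally integrable function `g` of
polynomial growth is the distribution `ψ ↦ ∫ ψ g`. -/
def IsWaveletRepresentation (φ : ℝ → ℂ) (f : 𝓢'(ℝ, E)) (c : ℤ → ℤ → E)
    (P : ℤ → ℤ → ℕ →₀ E) : Prop :=
  ∀ ψ : 𝓢(ℝ, ℂ), HasSum
    (fun i : ℤ × ℤ =>
      ∫ x : ℝ, ψ x • (waveletSystem φ i.1 i.2 x • c i.1 i.2 + polyFun (P i.1 i.2) x))
    (f ψ)

/-- The quasi-norm of a doubly indexed sequence `c` (translation index `j`, dilation index `n`):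
the `ℓ_q` quasi-norm over `n` of `2 ^ (n (s + 1/2 - 1/p)) ‖(‖c_{j,n}‖)_j‖_{ℓ_p}`. -/
def besovSeqNorm (s : ℝ) (p q : ℝ≥0∞) (c : ℤ → ℤ → E) : ℝ≥0∞ :=
  eLpNorm (fun n : ℤ => (2 : ℝ≥0∞) ^ ((n : ℝ) * (s + 1 / 2 - 1 / p.toReal)) *
    eLpNorm (fun j : ℤ => c j n) p Measure.count) q Measure.count

/-- Membership of an `E`-valued tempered distribution in the homogeneous Besov space
`Ḃ^s_{p,q}(ℝ, E)`, defined through the wavelet `φ`. -/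
def MemHomBesov (φ : ℝ → ℂ) (s : ℝ) (p q : ℝ≥0∞) (f : 𝓢'(ℝ, E)) : Prop :=
  ∃ (c : ℤ → ℤ → E) (P : ℤ → ℤ → ℕ →₀ E),
    IsWaveletRepresentation φ f c P ∧ besovSeqNorm s p q c < ∞

/-- The semi-quasi-norm of `Ḃ^s_{p,q}(ℝ, E)`: the infimum over all wavelet representations. -/
def homBesovSeminorm (φ : ℝ → ℂ) (s : ℝ) (p q : ℝ≥0∞) (f : 𝓢'(ℝ, E)) : ℝ≥0∞ :=
  ⨅ (c : ℤ → ℤ → E) (P : ℤ → ℤ → ℕ →₀ E) (_ : IsWaveletRepresentation φ f c P),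
    besovSeqNorm s p q c

end Besov

/-! ### Integral operators with square-integrable kernels -/

/-- `L₂(ℝ)`. -/
abbrev L2R : Type := Lp ℂ 2 (volume : Measure ℝ)

/-- `L₂(ℝ²)`. -/
abbrev L2R2 : Type := Lp ℂ 2 (volume : Measure (ℝ × ℝ))

theorem sq_eLpNorm_two {α : Type*} [MeasurableSpace α] (μ : Measure α) (f : α → ℂ) :
    eLpNorm f 2 μ ^ 2 = ∫⁻ a, ‖f a‖ₑ ^ 2 ∂μ := by
  have h := eLpNorm_nnreal_pow_eq_lintegral (μ := μ) (f := f) (p := 2) two_ne_zero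
  simp only [ENNReal.coe_ofNat, NNReal.coe_ofNat, ENNReal.rpow_two] at h
  exact h

/-- The function `y ↦ ∫ k(x, y) f(x) dx`. -/
def opFun (k : L2R2) (f : L2R) (y : ℝ) : ℂ := ∫ x : ℝ, k (x, y) * f x

theorem measurable_kernel_enorm (k : L2R2) : Measurable fun z : ℝ × ℝ => ‖k z‖ₑ ^ 2 :=
  ((Lp.stronglyMeasurable k).measurable.enorm).pow_const 2

theorem lintegral_kernel (k : L2R2) :
    ∫⁻ y : ℝ, ∫⁻ x : ℝ, ‖k (x, y)‖ₑ ^ 2 = ‖k‖ₑ ^ 2 := by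
  rw [Lp.enorm_def, sq_eLpNorm_two]
  exact (lintegral_prod_symm' (μ := (volume : Measure ℝ)) (ν := (volume : Measure ℝ)) _
    (measurable_kernel_enorm k)).symm

theorem memLp_slice (k : L2R2) :
    ∀ᵐ y : ℝ, MemLp (fun x : ℝ => k (x, y)) 2 volume := by
  have hfin : ∫⁻ y : ℝ, ∫⁻ x : ℝ, ‖k (x, y)‖ₑ ^ 2 ≠ ∞ := by
    rw [lintegral_kernel]
    exact ENNReal.pow_ne_top enorm_ne_top
  filter_upwards [ae_lt_top (measurable_kernel_enorm k).lintegral_prod_left' hfin] with y hy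
  refine ⟨((Lp.stronglyMeasurable k).comp_measurable
    measurable_prodMk_right).aestronglyMeasurable, ?_⟩
  rw [← sq_eLpNorm_two] at hy
  by_contra h
  rw [not_lt, top_le_iff] at h
  simp [h] at hy

theorem integrable_slice_mul (k : L2R2) (f : L2R) :
    ∀ᵐ y : ℝ, Integrable (fun x : ℝ => k (x, y) * f x) volume := by
  filter_upwards [memLp_slice k] with y hy
  exact hy.integrable_mul (Lp.memLp f)

theorem stronglyMeasurable_opFun (k : L2R2) (f : L2R) : StronglyMeasurable (opFun k f) := by
  have h : StronglyMeasurable fun z : ℝ × ℝ => k z * f z.1 :=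
    (Lp.stronglyMeasurable k).mul ((Lp.stronglyMeasurable f).comp_measurable measurable_fst)
  exact h.integral_prod_left'

theorem enorm_opFun_le (k : L2R2) (f : L2R) (y : ℝ) :
    ‖opFun k f y‖ₑ ^ 2 ≤ (∫⁻ x : ℝ, ‖k (x, y)‖ₑ ^ 2) * ‖f‖ₑ ^ 2 := by
  have hk : AEMeasurable (fun x : ℝ => ‖k (x, y)‖ₑ) volume :=
    ((Lp.stronglyMeasurable k).comp_measurable measurable_prodMk_right).measurable.enorm.aemeasurable
  have hf : AEMeasurable (fun x : ℝ => ‖f x‖ₑ) volume :=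
    (Lp.stronglyMeasurable f).measurable.enorm.aemeasurable
  have h1 : ‖opFun k f y‖ₑ ≤
      eLpNorm (fun x : ℝ => k (x, y)) 2 volume * eLpNorm f 2 volume := by
    calc ‖opFun k f y‖ₑ ≤ ∫⁻ x : ℝ, ‖k (x, y) * f x‖ₑ := enorm_integral_le_lintegral_enorm _
      _ = ∫⁻ x : ℝ, ((fun x : ℝ => ‖k (x, y)‖ₑ) * fun x : ℝ => ‖f x‖ₑ) x := by
          simp [enorm_mul]
      _ ≤ _ := ENNReal.lintegral_mul_le_Lp_mul_Lq volume Real.HolderConjugate.two_two hk hf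
      _ = _ := by
          simp [eLpNorm_eq_lintegral_rpow_enorm_toReal (p := 2) two_ne_zero ENNReal.ofNat_ne_top]
  calc ‖opFun k f y‖ₑ ^ 2
      ≤ (eLpNorm (fun x : ℝ => k (x, y)) 2 volume * eLpNorm f 2 volume) ^ 2 := by gcongr
    _ = _ := by rw [mul_pow, sq_eLpNorm_two, Lp.enorm_def]

theorem eLpNorm_opFun_le (k : L2R2) (f : L2R) :
    eLpNorm (opFun k f) 2 volume ≤ ‖k‖ₑ * ‖f‖ₑ := by
  have h : eLpNorm (opFun k f) 2 volume ^ 2 ≤ (‖k‖ₑ * ‖f‖ₑ) ^ 2 := by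
    rw [sq_eLpNorm_two, mul_pow, ← lintegral_kernel,
      ← lintegral_mul_const _ (measurable_kernel_enorm k).lintegral_prod_left']
    exact lintegral_mono fun y => enorm_opFun_le k f y
  exact (ENNReal.pow_le_pow_left_iff two_ne_zero).1 h

theorem memLp_opFun (k : L2R2) (f : L2R) : MemLp (opFun k f) 2 volume :=
  ⟨(stronglyMeasurable_opFun k f).aestronglyMeasurable,
    (eLpNorm_opFun_le k f).trans_lt (ENNReal.mul_lt_top enorm_lt_top enorm_lt_top)⟩

/-- The integral operator `Op(k) : L₂(ℝ) → L₂(ℝ)`, `(Op(k) f)(y) = ∫ k(x, y) f(x) dx`, of a kernel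
`k ∈ L₂(ℝ²)`. -/
def Op (k : L2R2) : L2R →L[ℂ] L2R :=
  LinearMap.mkContinuous
    { toFun := fun f => (memLp_opFun k f).toLp (opFun k f)
      map_add' := by
        intro f g
        rw [← MemLp.toLp_add]
        refine MemLp.toLp_congr _ _ ?_
        filter_upwards [integrable_slice_mul k f, integrable_slice_mul k g] with y hf hg
        simp only [opFun, Pi.add_apply]
        rw [← integral_add hf hg]
        refine integral_congr_ae ?_
        filter_upwards [Lp.coeFn_add f g] with x hx
        rw [hx, Pi.add_apply, mul_add]
      map_smul' := by
        intro a f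
        rw [RingHom.id_apply, ← MemLp.toLp_const_smul]
        refine MemLp.toLp_congr _ _ (Filter.Eventually.of_forall fun y => ?_)
        simp only [opFun, Pi.smul_apply]
        rw [← integral_smul]
        refine integral_congr_ae ?_
        filter_upwards [Lp.coeFn_smul a f] with x hx
        rw [hx, Pi.smul_apply, smul_eq_mul, smul_eq_mul, mul_left_comm] }
    ‖k‖
    (by
      intro f
      have h := ENNReal.toReal_mono (ENNReal.mul_ne_top enorm_ne_top enorm_ne_top)
        (eLpNorm_opFun_le k f)
      simpa [Lp.norm_toLp, ENNReal.toReal_mul] using h)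

theorem Op_apply_ae (k : L2R2) (f : L2R) :
    Op k f =ᵐ[volume] fun y : ℝ => ∫ x : ℝ, k (x, y) * f x :=
  MemLp.coeFn_toLp (memLp_opFun k f)

/-- A kernel `k ∈ L₂(ℝ²)` as the `L₂(ℝ)`-valued function `x ↦ k(x, ·)`, that is, as the
`L₂(ℝ)`-valued tempered distribution `ψ ↦ ∫ ψ(x) k(x, ·) dx`. -/
def kernelDistribution (k : L2R2) : 𝓢'(ℝ, L2R) :=
  ContinuousLinearMap.toPointwiseConvergenceCLM _ _ _ _
    ((Op k).comp (SchwartzMap.toLpCLM ℂ ℂ 2 (volume : Measure ℝ)))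

theorem kernelDistribution_apply_ae (k : L2R2) (ψ : 𝓢(ℝ, ℂ)) :
    kernelDistribution k ψ =ᵐ[volume] fun y : ℝ => ∫ x : ℝ, ψ x * k (x, y) := by
  refine (Op_apply_ae k (ψ.toLp 2 volume)).trans (Filter.Eventually.of_forall fun y => ?_)
  refine integral_congr_ae ?_
  filter_upwards [SchwartzMap.coeFn_toLp ψ 2 (volume : Measure ℝ)] with x hx
  rw [hx, mul_comm]

end

/-! ### Singular values against the image of an orthonormal basis. -/

section SingularValues

open InnerProductSpace Filter Topology

variable {H : Type*} [NormedAddCommGroup H] [InnerProductSpace ℂ H]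

/-! At the critical smoothness `s = 1/p - 1/2` the dyadic weights cancel, so the Besov quasi-norm of
a representation is the plain `ℓ_p` quasi-norm of all its coefficients (`besovSeqNorm_eq_tsum`).

These coefficients are the values of `Op k` on an orthonormal basis, the complex conjugates of the
wavelets (`Op_star_wavelet_eq`). To see this, test the representation on Schwartz functions with
vanishing moments: the polynomials disappear, and such functions are still total in `L₂`. Since `p ≤
2`, the coefficients are square summable, which lets the identity pass from the test functions to
the basis.

It remains to bound `∑ μ(n, T)^p` by `∑ ‖T e_i‖^p` for an orthonormal basis `e` and `p ≤ 2`
(`tsum_singularValue_rpow_le`). In finite dimensions this is Jensen's inequality for `t ↦ t^(p/2)`;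
the general case follows by truncation. The resulting constant is `1`. -/

theorem singularValue_le_of_rank_le {n : ℕ} {T : H →L[ℂ] H} (R : H →L[ℂ] H)
    (hR : LinearMap.rank (R : H →ₗ[ℂ] H) ≤ (n : Cardinal)) :
    singularValue n T ≤ ‖T - R‖ₑ :=
  iInf₂_le R hR

theorem singularValue_le_add (n : ℕ) (T S : H →L[ℂ] H) :
    singularValue n T ≤ singularValue n S + ‖T - S‖ₑ := by
  unfold singularValue
  simp only [ENNReal.iInf_add]
  refine le_iInf₂ fun R hR => (iInf₂_le R hR).trans ?_
  have : T - R = (S - R) + (T - S) := by abel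
  rw [this]
  exact enorm_add_le (S - R) (T - S)

theorem singularValue_ne_top (n : ℕ) (T : H →L[ℂ] H) : singularValue n T ≠ ∞ := by
  refine ne_top_of_le_ne_top (enorm_ne_top (x := T - 0))
    (singularValue_le_of_rank_le 0 ?_)
  simp

theorem rank_comp_le_card {ι : Type} [Fintype ι]
    (A : EuclideanSpace ℂ ι →L[ℂ] H) (J : H →L[ℂ] EuclideanSpace ℂ ι) :
    LinearMap.rank ((A ∘L J : H →L[ℂ] H) : H →ₗ[ℂ] H) ≤ (Fintype.card ι : Cardinal) := by
  have h1 : LinearMap.rank ((A ∘L J : H →L[ℂ] H) : H →ₗ[ℂ] H) ≤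
      LinearMap.rank (A : EuclideanSpace ℂ ι →ₗ[ℂ] H) := by
    rw [ContinuousLinearMap.toLinearMap_comp]
    exact LinearMap.rank_comp_le_left _ _
  have h2 : Cardinal.lift.{_, _} (LinearMap.rank (A : EuclideanSpace ℂ ι →ₗ[ℂ] H)) ≤ _ :=
    lift_rank_range_le (A : EuclideanSpace ℂ ι →ₗ[ℂ] H)
  rw [← Module.finrank_eq_rank ℂ (EuclideanSpace ℂ ι), finrank_euclideanSpace] at h2
  refine h1.trans ?_
  simpa using h2

section Diagonalisation

variable [CompleteSpace H]

variable {ι : Type} [Fintype ι] (A : EuclideanSpace ℂ ι →L[ℂ] H)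

theorem isSymmetric_adjoint_comp_self :
    ((ContinuousLinearMap.adjoint A ∘L A : EuclideanSpace ℂ ι →L[ℂ] EuclideanSpace ℂ ι) :
      EuclideanSpace ℂ ι →ₗ[ℂ] EuclideanSpace ℂ ι).IsSymmetric := by
  intro x y
  simp [ContinuousLinearMap.adjoint_inner_left, ContinuousLinearMap.adjoint_inner_right]

/-- The squared singular values of `A`, in decreasing order. -/
noncomputable def sqSingular : Fin (Fintype.card ι) → ℝ :=
  (isSymmetric_adjoint_comp_self A).eigenvalues finrank_euclideanSpace

/-- An orthonormal basis of right singular vectors of `A`. -/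
noncomputable def rightSingular :
    OrthonormalBasis (Fin (Fintype.card ι)) ℂ (EuclideanSpace ℂ ι) :=
  (isSymmetric_adjoint_comp_self A).eigenvectorBasis finrank_euclideanSpace

theorem sqSingular_antitone : Antitone (sqSingular A) :=
  (isSymmetric_adjoint_comp_self A).eigenvalues_antitone finrank_euclideanSpace

theorem norm_sq_apply_eq_sum (y : EuclideanSpace ℂ ι) :
    ‖A y‖ ^ 2 = ∑ k, sqSingular A k * ‖⟪rightSingular A k, y⟫_ℂ‖ ^ 2 := by
  have hS (k) : (ContinuousLinearMap.adjoint A ∘L A) (rightSingular A k) =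
      (sqSingular A k : ℂ) • rightSingular A k :=
    (isSymmetric_adjoint_comp_self A).apply_eigenvectorBasis finrank_euclideanSpace k
  have h : ((‖A y‖ ^ 2 : ℝ) : ℂ) =
      ((∑ k, sqSingular A k * ‖⟪rightSingular A k, y⟫_ℂ‖ ^ 2 : ℝ) : ℂ) := by
    have h1 : ((‖A y‖ ^ 2 : ℝ) : ℂ) = ⟪(ContinuousLinearMap.adjoint A ∘L A) y, y⟫_ℂ := by
      rw [ContinuousLinearMap.comp_apply, ContinuousLinearMap.adjoint_inner_left,
        inner_self_eq_norm_sq_to_K]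
      simp
    rw [h1, ← OrthonormalBasis.sum_inner_mul_inner (rightSingular A)]
    rw [Complex.ofReal_sum]
    refine Finset.sum_congr rfl fun k _ => ?_
    have h2 : ⟪(ContinuousLinearMap.adjoint A ∘L A) y, rightSingular A k⟫_ℂ =
        ⟪y, (ContinuousLinearMap.adjoint A ∘L A) (rightSingular A k)⟫_ℂ :=
      isSymmetric_adjoint_comp_self A y _
    rw [h2, hS, inner_smul_right, mul_assoc, ← inner_conj_symm y, ← Complex.normSq_eq_conj_mul_self,
      Complex.normSq_eq_norm_sq]
    simp
  exact_mod_cast h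

theorem norm_sq_apply_rightSingular (k : Fin (Fintype.card ι)) :
    ‖A (rightSingular A k)‖ ^ 2 = sqSingular A k := by
  classical
  rw [norm_sq_apply_eq_sum]
  simp [OrthonormalBasis.inner_eq_ite, apply_ite]

theorem sqSingular_nonneg (k : Fin (Fintype.card ι)) : 0 ≤ sqSingular A k := by
  rw [← norm_sq_apply_rightSingular]
  positivity

/-- The competitor is `A Q J`, with `Q` the projection onto the first `k` right singular vectors.
What remains of `A` only sees squared singular values at most `sqSingular A k`. Indices start at
`0`, so `Q` has rank exactly `k`. -/
theorem singularValue_comp_le (J : H →L[ℂ] EuclideanSpace ℂ ι) (hJ : ‖J‖ ≤ 1)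
    (k : Fin (Fintype.card ι)) :
    singularValue k (A ∘L J) ≤ ENNReal.ofReal (√(sqSingular A k)) := by
  set v := rightSingular A
  let Q : EuclideanSpace ℂ ι →L[ℂ] EuclideanSpace ℂ ι :=
    ∑ l ∈ Finset.Iio k, rankOne ℂ (v l) (v l)
  have hrank : LinearMap.rank ((A ∘L Q ∘L J : H →L[ℂ] H) : H →ₗ[ℂ] H) ≤
      ((k : ℕ) : Cardinal) := by
    have hQ : (A ∘L Q ∘L J : H →L[ℂ] H) =
        ∑ l ∈ Finset.Iio k, rankOne ℂ (A (v l)) (ContinuousLinearMap.adjoint J (v l)) := by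
      ext x
      simp [Q, ContinuousLinearMap.adjoint_inner_left]
    rw [hQ, ContinuousLinearMap.toLinearMap_sum]
    refine (LinearMap.rank_finsetSum_le _ _).trans ?_
    calc _ ≤ ∑ l ∈ Finset.Iio k, (1 : Cardinal) := by
          refine Finset.sum_le_sum fun l _ => ?_
          refine (Submodule.rank_mono (t := ℂ ∙ A (v l)) ?_).trans (rank_span_le _ |>.trans (by simp))
          rintro _ ⟨x, rfl⟩
          exact Submodule.mem_span_singleton.2 ⟨_, (by simp; rfl)⟩
      _ = _ := by simp
  refine (singularValue_le_of_rank_le _ hrank).trans ?_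
  rw [← ofReal_norm]
  refine ENNReal.ofReal_le_ofReal (ContinuousLinearMap.opNorm_le_bound _ (Real.sqrt_nonneg _) ?_)
  intro x
  have hz (l) : ⟪v l, J x - Q (J x)⟫_ℂ = if l < k then 0 else ⟪v l, J x⟫_ℂ := by
    simp only [Q, sum_apply, inner_sub_right, inner_sum, rankOne_apply,
      inner_smul_right, OrthonormalBasis.inner_eq_ite]
    by_cases hl : l < k <;> simp [hl]
  have hx : (A ∘L J - A ∘L Q ∘L J) x = A (J x - Q (J x)) := by simp
  have key : ‖A (J x - Q (J x))‖ ^ 2 ≤ sqSingular A k * ‖x‖ ^ 2 := by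
    rw [norm_sq_apply_eq_sum]
    have hJx : ‖J x‖ ≤ ‖x‖ := by simpa using J.le_of_opNorm_le hJ x
    calc _ ≤ ∑ l, sqSingular A k * ‖⟪v l, J x⟫_ℂ‖ ^ 2 := by
          refine Finset.sum_le_sum fun l _ => ?_
          rw [hz]
          split_ifs with hl
          · simpa using mul_nonneg (sqSingular_nonneg A k) (by positivity)
          · exact mul_le_mul_of_nonneg_right (sqSingular_antitone A (not_lt.1 hl)) (by positivity)
      _ = sqSingular A k * ‖J x‖ ^ 2 := by
          rw [← Finset.mul_sum, OrthonormalBasis.sum_sq_norm_inner_right]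
      _ ≤ _ := by gcongr; exact sqSingular_nonneg A k
  rw [hx, ← Real.sqrt_sq (norm_nonneg x), ← Real.sqrt_mul (sqSingular_nonneg A k)]
  exact Real.le_sqrt_of_sq_le key

/-- Each `‖A (e i)‖ ^ 2` is an average of the squared singular values with weights `|⟪v_k, e_i⟫|²`.
Concavity of `t ↦ t^(p/2)` bounds it for each `i`; the weights form a doubly stochastic matrix, so
summing over `i` counts each singular value once. -/
theorem sum_sqSingular_rpow_le {p : ℝ} (hp0 : 0 < p) (hp2 : p ≤ 2)
    (e : OrthonormalBasis ι ℂ (EuclideanSpace ℂ ι)) :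
    ∑ k, √(sqSingular A k) ^ p ≤ ∑ i, ‖A (e i)‖ ^ p := by
  have hsq (x : ℝ) (hx : 0 ≤ x) : (x ^ 2) ^ (p / 2) = x ^ p := by
    rw [← Real.rpow_natCast, ← Real.rpow_mul hx]; congr 1; push_cast; ring
  have hconc := Real.concaveOn_rpow (p := p / 2) (by positivity) (by linarith)
  calc ∑ k, √(sqSingular A k) ^ p
      = ∑ k, (∑ i, ‖⟪rightSingular A k, e i⟫_ℂ‖ ^ 2) * sqSingular A k ^ (p / 2) := by
        refine Finset.sum_congr rfl fun k _ => ?_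
        rw [OrthonormalBasis.sum_sq_norm_inner_left, ← hsq _ (Real.sqrt_nonneg _),
          Real.sq_sqrt (sqSingular_nonneg A k)]
        simp
    _ = ∑ i, ∑ k, ‖⟪rightSingular A k, e i⟫_ℂ‖ ^ 2 * sqSingular A k ^ (p / 2) := by
        simp_rw [Finset.sum_mul]
        exact Finset.sum_comm
    _ ≤ ∑ i, ‖A (e i)‖ ^ p := by
        refine Finset.sum_le_sum fun i _ => ?_
        rw [← hsq _ (norm_nonneg _), norm_sq_apply_eq_sum]
        have := hconc.le_map_sum (t := Finset.univ)
          (w := fun k => ‖⟪rightSingular A k, e i⟫_ℂ‖ ^ 2) (p := sqSingular A)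
          (fun k _ => by positivity)
          (by rw [OrthonormalBasis.sum_sq_norm_inner_right]; simp)
          (fun k _ => sqSingular_nonneg A k)
        simpa [mul_comm] using this

theorem sum_singularValue_comp_rpow_le {p : ℝ} (hp0 : 0 < p) (hp2 : p ≤ 2)
    (e : OrthonormalBasis ι ℂ (EuclideanSpace ℂ ι))
    (J : H →L[ℂ] EuclideanSpace ℂ ι) (hJ : ‖J‖ ≤ 1) :
    ∑' n, singularValue n (A ∘L J) ^ p ≤ ∑ i, ‖A (e i)‖ₑ ^ p := by
  have hz (n : ℕ) (hn : n ∉ Finset.range (Fintype.card ι)) :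
      singularValue n (A ∘L J) ^ p = 0 := by
    have h : singularValue n (A ∘L J) = 0 := by
      refine le_antisymm ((singularValue_le_of_rank_le (A ∘L J)
        ((rank_comp_le_card A J).trans ?_)).trans (by simp)) zero_le
      exact_mod_cast not_lt.1 (Finset.mem_range.not.1 hn)
    rw [h, ENNReal.zero_rpow_of_pos hp0]
  rw [tsum_eq_sum hz, Finset.sum_range]
  calc _ ≤ ∑ k : Fin (Fintype.card ι), ENNReal.ofReal (√(sqSingular A k) ^ p) := by
        refine Finset.sum_le_sum fun k _ => ?_
        rw [← ENNReal.ofReal_rpow_of_nonneg (Real.sqrt_nonneg _) hp0.le]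
        gcongr
        exact singularValue_comp_le A J hJ k
    _ = ENNReal.ofReal (∑ k, √(sqSingular A k) ^ p) :=
        (ENNReal.ofReal_sum_of_nonneg fun k _ => by positivity).symm
    _ ≤ ENNReal.ofReal (∑ i, ‖A (e i)‖ ^ p) :=
        ENNReal.ofReal_le_ofReal (sum_sqSingular_rpow_le A hp0 hp2 e)
    _ = _ := by
        rw [ENNReal.ofReal_sum_of_nonneg fun i _ => by positivity]
        refine Finset.sum_congr rfl fun i _ => ?_
        rw [← ENNReal.ofReal_rpow_of_nonneg (norm_nonneg _) hp0.le, ofReal_norm]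

end Diagonalisation

section Truncation

variable {ι : Type} (b : HilbertBasis ι ℂ H)

/-- The coordinate map `x ↦ (⟪b i, x⟫)_{i ∈ F}`. -/
noncomputable def coordMap (F : Finset ι) : H →L[ℂ] EuclideanSpace ℂ F :=
  ((EuclideanSpace.equiv F ℂ).symm : (F → ℂ) →L[ℂ] EuclideanSpace ℂ F) ∘L
    ContinuousLinearMap.pi fun i : F => innerSL ℂ (b i)

theorem coordMap_apply (F : Finset ι) (x : H) (i : F) : coordMap b F x i = ⟪b i, x⟫_ℂ := rfl

theorem norm_coordMap_le (F : Finset ι) : ‖coordMap b F‖ ≤ 1 := by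
  refine ContinuousLinearMap.opNorm_le_bound _ zero_le_one fun x => ?_
  rw [one_mul, EuclideanSpace.norm_eq]
  refine Real.sqrt_le_left (norm_nonneg x) |>.2 ?_
  simp only [coordMap_apply]
  rw [Finset.sum_coe_sort F fun i => ‖⟪b i, x⟫_ℂ‖ ^ 2]
  exact b.orthonormal.sum_inner_products_le x

/-- The operator norm is at most the Hilbert–Schmidt norm, by Cauchy–Schwarz on the expansion of
`x`. -/
theorem norm_le_of_sum_norm_sq_le (T : H →L[ℂ] H) {M : ℝ}
    (hM : ∀ s : Finset ι, ∑ i ∈ s, ‖T (b i)‖ ^ 2 ≤ M) : ‖T‖ ≤ √M := by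
  refine ContinuousLinearMap.opNorm_le_bound _ (Real.sqrt_nonneg _) fun x => ?_
  have hs : HasSum (fun i => b.repr x i • T (b i)) (T x) := by
    simpa using (b.hasSum_repr x).mapL T
  refine le_of_tendsto hs.norm (Eventually.of_forall fun s => ?_)
  calc ‖∑ i ∈ s, b.repr x i • T (b i)‖ ≤ ∑ i ∈ s, ‖⟪b i, x⟫_ℂ‖ * ‖T (b i)‖ := by
        refine (norm_sum_le _ _).trans (le_of_eq ?_)
        simp [norm_smul, b.repr_apply_apply]
    _ ≤ √(∑ i ∈ s, ‖⟪b i, x⟫_ℂ‖ ^ 2) * √(∑ i ∈ s, ‖T (b i)‖ ^ 2) :=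
        Real.sum_mul_le_sqrt_mul_sqrt _ _ _
    _ ≤ ‖x‖ * √M := by
        gcongr
        · exact (Real.sqrt_le_left (norm_nonneg x)).2 (b.orthonormal.sum_inner_products_le x)
        · exact hM s
    _ = _ := mul_comm _ _

/-- The operator that agrees with `T` on `b i`, `i ∈ F`, and vanishes on the other `b i` is
`truncOp b T F ∘L coordMap b F`. -/
noncomputable def truncOp (T : H →L[ℂ] H) (F : Finset ι) : EuclideanSpace ℂ F →L[ℂ] H :=
  LinearMap.toContinuousLinearMap
    ((EuclideanSpace.basisFun F ℂ).toBasis.constr ℂ fun i : F => T (b i))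

theorem truncOp_basisFun (T : H →L[ℂ] H) (F : Finset ι) (i : F) :
    truncOp b T F (EuclideanSpace.basisFun F ℂ i) = T (b i) := by
  have := (EuclideanSpace.basisFun F ℂ).toBasis.constr_basis ℂ (fun i : F => T (b i)) i
  simpa [truncOp] using this

theorem truncOp_coordMap_of_mem (T : H →L[ℂ] H) {F : Finset ι} {i : ι} (hi : i ∈ F) :
    truncOp b T F (coordMap b F (b i)) = T (b i) := by
  classical
  rw [← truncOp_basisFun b T F ⟨i, hi⟩]
  congr 1
  ext j
  rw [coordMap_apply, orthonormal_iff_ite.1 b.orthonormal]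
  simp [Subtype.ext_iff]

theorem truncOp_coordMap_of_notMem (T : H →L[ℂ] H) {F : Finset ι} {i : ι} (hi : i ∉ F) :
    truncOp b T F (coordMap b F (b i)) = 0 := by
  classical
  have : coordMap b F (b i) = 0 := by
    ext j
    rw [coordMap_apply, orthonormal_iff_ite.1 b.orthonormal]
    have : (j : ι) ≠ i := fun h => hi (h ▸ j.2)
    simp [this]
  rw [this, map_zero]

/-- The error vanishes on `b i` for `i ∈ F`, so its Hilbert–Schmidt norm is controlled by the tail
of a convergent series. -/
theorem tendsto_truncOp_comp_coordMap (T : H →L[ℂ] H) (hT : Summable fun i => ‖T (b i)‖ ^ 2) :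
    Tendsto (fun F => truncOp b T F ∘L coordMap b F) atTop (𝓝 T) := by
  classical
  rw [tendsto_iff_norm_sub_tendsto_zero]
  have h0 : Tendsto (fun F : Finset ι => √(∑' i, ‖T (b i)‖ ^ 2 - ∑ i ∈ F, ‖T (b i)‖ ^ 2))
      atTop (𝓝 0) := by
    have h := (tendsto_const_nhds (x := ∑' i, ‖T (b i)‖ ^ 2)).sub
      (show Tendsto (fun F : Finset ι => ∑ i ∈ F, ‖T (b i)‖ ^ 2) atTop _ from hT.hasSum)
    rw [sub_self] at h
    simpa using h.sqrt
  refine squeeze_zero (fun _ => norm_nonneg _) (fun F => ?_) h0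
  refine norm_le_of_sum_norm_sq_le b _ fun s => ?_
  have h1 : ∑ i ∈ s, ‖(truncOp b T F ∘L coordMap b F - T) (b i)‖ ^ 2 =
      ∑ i ∈ s \ F, ‖T (b i)‖ ^ 2 := by
    rw [← Finset.sum_sdiff (Finset.inter_subset_left (s₁ := s) (s₂ := F)),
      Finset.sdiff_inter_self_left, Finset.sum_eq_zero (s := s ∩ F), add_zero]
    · refine Finset.sum_congr rfl fun i hi => ?_
      rw [sub_apply, ContinuousLinearMap.comp_apply,
        truncOp_coordMap_of_notMem b T (Finset.mem_sdiff.1 hi).2, zero_sub, norm_neg]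
    · intro i hi
      rw [sub_apply, ContinuousLinearMap.comp_apply,
        truncOp_coordMap_of_mem b T (Finset.mem_inter.1 hi).2]
      simp
  rw [h1, le_sub_iff_add_le, ← Finset.sum_union Finset.sdiff_disjoint]
  exact hT.sum_le_tsum _ fun i _ => by positivity

/-- The inclusion `ℓ_p ⊆ ℓ_2` for `p ≤ 2`. -/
theorem summable_norm_sq_of_tsum_enorm_rpow {E : Type*} [NormedAddCommGroup E] {a : ι → E} {p : ℝ}
    (hp0 : 0 < p) (hp2 : p ≤ 2) (h : ∑' i, ‖a i‖ₑ ^ p ≠ ∞) : Summable fun i => ‖a i‖ ^ 2 := by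
  have h1 : Summable fun i => ‖a i‖ ^ p := by
    refine (ENNReal.summable_toReal h).congr fun i => ?_
    rw [← ENNReal.toReal_rpow, toReal_enorm]
  have hp : 0 < (ENNReal.ofReal p).toReal := by rwa [ENNReal.toReal_ofReal hp0.le]
  have h2 : Memℓp (E := fun _ => E) a (ENNReal.ofReal p) := by
    rw [memℓp_gen_iff hp, ENNReal.toReal_ofReal hp0.le]
    exact h1
  have h3 := h2.of_exponent_ge (p := 2) (by simpa using ENNReal.ofReal_le_ofReal hp2)
  rw [memℓp_gen_iff (by simp)] at h3
  simpa using h3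

theorem isCompactOperator_of_summable [CompleteSpace H] (T : H →L[ℂ] H)
    (hT : Summable fun i => ‖T (b i)‖ ^ 2) :
    IsCompactOperator T := by
  refine isCompactOperator_of_tendsto (tendsto_truncOp_comp_coordMap b T hT)
    (Eventually.of_forall fun F => ?_)
  have : IsCompactOperator (truncOp b T F) :=
    isCompactOperator_of_locallyCompactSpace_rng (truncOp b T F)
  exact this.comp_clm (coordMap b F)

/-- For `p ≤ 2` the Schatten quasi-norm is dominated by the `ℓ_p` quasi-norm of the image of an
orthonormal basis. -/
theorem tsum_singularValue_rpow_le [CompleteSpace H] (T : H →L[ℂ] H) {p : ℝ} (hp0 : 0 < p)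
    (hp2 : p ≤ 2)
    (hT : Summable fun i => ‖T (b i)‖ ^ 2) :
    ∑' n, singularValue n T ^ p ≤ ∑' i, ‖T (b i)‖ₑ ^ p := by
  have h0 : Tendsto (fun F => ‖T - truncOp b T F ∘L coordMap b F‖ₑ) atTop (𝓝 0) := by
    have h := ((tendsto_const_nhds (x := T)).sub (tendsto_truncOp_comp_coordMap b T hT)).enorm
    simpa using h
  rw [ENNReal.tsum_eq_iSup_sum]
  refine iSup_le fun s => ?_
  -- Singular values are 1-Lipschitz in operator norm. Subtracting the error before taking powers
  -- gives a lower bound for those of the truncation that converges to those of `T`, without a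
  -- quasi-triangle constant when `p < 1`.
  have hlim : Tendsto (fun F => ∑ n ∈ s,
      (singularValue n T - ‖T - truncOp b T F ∘L coordMap b F‖ₑ) ^ p) atTop
      (𝓝 (∑ n ∈ s, singularValue n T ^ p)) := by
    refine tendsto_finsetSum _ fun n _ => ?_
    have h := ENNReal.Tendsto.sub (tendsto_const_nhds (x := singularValue n T)) h0
      (Or.inl (singularValue_ne_top n T))
    rw [tsub_zero] at h
    exact (ENNReal.continuous_rpow_const.tendsto _).comp h
  refine le_of_tendsto hlim (Eventually.of_forall fun F => ?_)
  calc _ ≤ ∑ n ∈ s, singularValue n (truncOp b T F ∘L coordMap b F) ^ p := by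
        gcongr with n
        exact tsub_le_iff_right.2 (singularValue_le_add n _ _)
    _ ≤ ∑' n, singularValue n (truncOp b T F ∘L coordMap b F) ^ p := ENNReal.sum_le_tsum _
    _ ≤ ∑ i : F, ‖truncOp b T F (EuclideanSpace.basisFun F ℂ i)‖ₑ ^ p :=
        sum_singularValue_comp_rpow_le _ hp0 hp2 _ _ (norm_coordMap_le b F)
    _ = ∑ i ∈ F, ‖T (b i)‖ₑ ^ p := by
        simp only [truncOp_basisFun]
        exact Finset.sum_coe_sort F fun i => ‖T (b i)‖ₑ ^ p
    _ ≤ _ := ENNReal.sum_le_tsum _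

end Truncation

end SingularValues

/-! ### Test functions that annihilate polynomials. -/

section VanishingMoments

open Filter Topology FourierTransform InnerProductSpace

/-- All moments of the Schwartz function `ψ` vanish. -/
def HasVanishingMoments (ψ : 𝓢(ℝ, ℂ)) : Prop :=
  ∀ n : ℕ, ∫ x : ℝ, ψ x * (x : ℂ) ^ n = 0

theorem integrable_schwartz_mul_pow (ψ : 𝓢(ℝ, ℂ)) (n : ℕ) :
    Integrable (fun x : ℝ => ψ x * (x : ℂ) ^ n) := by
  refine (ψ.integrable_pow_mul volume n).mono' (by fun_prop) (Eventually.of_forall fun x => ?_)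
  simp [mul_comm]

/-- Up to nonzero factors, the moments are the derivatives of the Fourier transform at `0`. -/
theorem hasVanishingMoments_of_fourier_eventuallyEq (ψ : 𝓢(ℝ, ℂ))
    (h : ((𝓕 ψ : 𝓢(ℝ, ℂ)) : ℝ → ℂ) =ᶠ[𝓝 0] 0) : HasVanishingMoments ψ := by
  intro n
  have h1 : iteratedDeriv n (𝓕 (ψ : ℝ → ℂ)) 0 = 0 := by
    rw [SchwartzMap.fourier_coe] at h
    rw [h.iteratedDeriv_eq n]
    simp [Pi.zero_def]
  rw [Real.iteratedDeriv_fourier (N := ⊤) (fun m _ => ?_) le_top] at h1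
  · rw [Real.fourier_eq] at h1
    simp only [inner_zero_right, neg_zero, AddChar.map_zero_eq_one, one_smul, mul_pow,
      smul_eq_mul] at h1
    have h2 : ∀ x : ℝ, (-2 : ℂ) ^ n * (Real.pi : ℂ) ^ n * Complex.I ^ n * (x : ℂ) ^ n * ψ x =
        ((-2 : ℂ) ^ n * (Real.pi : ℂ) ^ n * Complex.I ^ n) * (ψ x * (x : ℂ) ^ n) := fun x => by ring
    simp only [h2, integral_const_mul] at h1
    simpa [Real.pi_ne_zero] using h1
  · refine (integrable_schwartz_mul_pow ψ m).congr (Eventually.of_forall fun x => ?_)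
    simp [mul_comm]

/-- The Schwartz functions with vanishing moments are total in `L₂(ℝ)`. -/
theorem eq_zero_of_forall_inner_vanishingMoments (u : L2R)
    (h : ∀ ψ : 𝓢(ℝ, ℂ), HasVanishingMoments ψ → ⟪ψ.toLp 2 volume, u⟫_ℂ = 0) : u = 0 := by
  -- Inverse Fourier transforms of bumps supported away from `0` have vanishing moments; by
  -- Plancherel they test `𝓕 u` everywhere except at the null set `{0}`.
  have h0 : ∀ᵐ ξ : ℝ, ξ ∈ ({0}ᶜ : Set ℝ) → (𝓕 u : L2R) ξ = 0 := by
    refine isOpen_compl_singleton.ae_eq_zero_of_integral_contDiff_smul_eq_zero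
      ((Lp.memLp _).locallyIntegrable (by norm_num) |>.locallyIntegrableOn _) ?_
    intro g hg hgs hgt
    have hgs' : HasCompactSupport fun x => (g x : ℂ) := hgs.comp_left (g := Complex.ofReal) rfl
    let η : 𝓢(ℝ, ℂ) := hgs'.toSchwartzMap (Complex.ofRealCLM.contDiff.comp hg)
    have hη (x : ℝ) : η x = g x := rfl
    have hF : 𝓕 (𝓕⁻ η) = η := fourier_fourierInv_eq η
    have hψ : HasVanishingMoments (𝓕⁻ η) := by
      refine hasVanishingMoments_of_fourier_eventuallyEq _ ?_
      rw [hF]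
      have : (0 : ℝ) ∉ tsupport g := fun h => hgt h rfl
      filter_upwards [notMem_tsupport_iff_eventuallyEq.1 this] with x hx
      simp [hη, hx]
    have h1 := h _ hψ
    rw [← Lp.inner_fourier_eq, SchwartzMap.toLp_fourier_eq, hF, L2.inner_def] at h1
    rw [← h1]
    refine integral_congr_ae ?_
    filter_upwards [SchwartzMap.coeFn_toLp η 2 (volume : Measure ℝ)] with x hx
    rw [hx, hη]
    simp [mul_comm]
  have h1 : (𝓕 u : L2R) = 0 := by
    rw [Lp.eq_zero_iff_ae_eq_zero]
    filter_upwards [h0, Measure.ae_ne volume (0 : ℝ)] with x hx hx0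
    exact hx hx0
  rw [← norm_eq_zero, ← Lp.norm_fourier_eq, h1, norm_zero]

theorem integral_smul_add_polyFun {E : Type*} [NormedAddCommGroup E] [NormedSpace ℂ E]
    [CompleteSpace E] {ψ : 𝓢(ℝ, ℂ)} (hψ : HasVanishingMoments ψ) (P : ℕ →₀ E) {w : ℝ → ℂ}
    (hw : Integrable fun x => ψ x * w x) (a : E) :
    ∫ x : ℝ, ψ x • (w x • a + polyFun P x) = (∫ x, ψ x * w x) • a := by
  have h (x : ℝ) : ψ x • (w x • a + polyFun P x) =
      (ψ x * w x) • a + ∑ n ∈ P.support, (ψ x * (x : ℂ) ^ n) • P n := by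
    simp [polyFun, Finsupp.sum, Finset.smul_sum, smul_smul]
  have hi (n : ℕ) : Integrable (fun x : ℝ => (ψ x * (x : ℂ) ^ n) • P n) :=
    (integrable_schwartz_mul_pow ψ n).smul_const _
  simp only [h]
  rw [integral_add (hw.smul_const a) (integrable_finsetSum _ fun n _ => hi n),
    integral_finsetSum _ fun n _ => hi n, integral_smul_const, Finset.sum_eq_zero, add_zero]
  intro n _
  rw [integral_smul_const, hψ n, zero_smul]

end VanishingMoments

/-! ### Conjugate bases. -/

section Conjugation

open InnerProductSpace ComplexConjugate

theorem inner_star_left_L2 (f g : L2R) : ⟪star f, g⟫_ℂ = ⟪star g, f⟫_ℂ := by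
  rw [L2.inner_def, L2.inner_def]
  refine integral_congr_ae ?_
  filter_upwards [Lp.coeFn_star f, Lp.coeFn_star g] with x hf hg
  rw [hf, hg]
  simp [mul_comm]

/-- The integral operator and the distribution pairing are bilinear: `∫ ψ w = ⟪star w, ψ⟫`. Hence
the basis dual to the wavelet expansion is the conjugated one. -/
theorem exists_conj_hilbertBasis {ι : Type*} (b : HilbertBasis ι ℂ L2R) :
    ∃ e : HilbertBasis ι ℂ L2R, ∀ i, e i = star (b i) := by
  classical
  have ho : Orthonormal ℂ fun i => star (b i) := by
    rw [orthonormal_iff_ite]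
    intro i j
    rw [inner_star_left_L2, star_star, orthonormal_iff_ite.1 b.orthonormal]
    simp [eq_comm]
  have hs : (Submodule.span ℂ (Set.range fun i => star (b i)))ᗮ = ⊥ := by
    rw [Submodule.eq_bot_iff]
    intro f hf
    have h (i) : ⟪b i, star f⟫_ℂ = 0 := by
      rw [← inner_conj_symm, inner_star_left_L2,
        (Submodule.mem_orthogonal _ _).1 hf _ (Submodule.subset_span ⟨i, rfl⟩), map_zero]
    have h0 : star f = 0 := by
      rw [← b.repr.map_eq_zero_iff]
      ext i
      simpa [b.repr_apply_apply] using h i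
    have h1 := inner_star_left_L2 f (star f)
    rw [star_star, h0, inner_zero_right] at h1
    exact inner_self_eq_zero.1 h1.symm
  exact ⟨HilbertBasis.mkOfOrthogonalEqBot ho hs, fun i => by
    rw [HilbertBasis.coe_mkOfOrthogonalEqBot]⟩

end Conjugation

/-! ### Identification of the coefficients and conclusion. -/

section Coefficients

open InnerProductSpace Filter

/-- Square summability of `c` provides, for each `h`, a vector `w` with coordinates `⟪c i, h⟫`. The
expansions on `D` show that `T* h` and `w` have the same inner products with `D`, hence are equal;
their coordinates then give `T (e i) = c i` weakly. -/
theorem apply_hilbertBasis_eq_of_hasSum {ι H : Type*} [NormedAddCommGroup H]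
    [InnerProductSpace ℂ H] [CompleteSpace H] (T : H →L[ℂ] H) (e : HilbertBasis ι ℂ H)
    (c : ι → H) (hc : Summable fun i => ‖c i‖ ^ 2) (D : Set H)
    (hD : ∀ u, (∀ d ∈ D, ⟪d, u⟫_ℂ = 0) → u = 0)
    (hT : ∀ d ∈ D, HasSum (fun i => ⟪e i, d⟫_ℂ • c i) (T d)) (i : ι) : T (e i) = c i := by
  refine ext_inner_right ℂ fun h => ?_
  have hmem : Memℓp (E := fun _ => ℂ) (fun i => ⟪c i, h⟫_ℂ) 2 := by
    rw [memℓp_gen_iff (by simp)]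
    refine (hc.mul_right (‖h‖ ^ 2)).of_nonneg_of_le (fun i => by positivity) fun i => ?_
    rw [ENNReal.toReal_ofNat, Real.rpow_two, ← mul_pow]
    gcongr
    exact norm_inner_le_norm _ _
  set w : H := e.repr.symm ⟨_, hmem⟩
  have hw (i) : ⟪e i, w⟫_ℂ = ⟪c i, h⟫_ℂ := by
    rw [← e.repr_apply_apply, LinearIsometryEquiv.apply_symm_apply]
  have hadj : ContinuousLinearMap.adjoint T h = w := by
    refine sub_eq_zero.1 (hD _ fun d hd => ?_)
    rw [inner_sub_right, ContinuousLinearMap.adjoint_inner_right, sub_eq_zero]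
    have h1 := e.hasSum_inner_mul_inner d w
    have h2 : HasSum (fun i => ⟪h, ⟪e i, d⟫_ℂ • c i⟫_ℂ) ⟪h, T d⟫_ℂ :=
      (hT d hd).mapL (innerSL ℂ h)
    have h3 := h2.map (starRingEnd ℂ) Complex.continuous_conj
    rw [inner_conj_symm] at h3
    refine h3.unique (h1.congr_fun ?_)
    intro i
    simp [hw]
  rw [← hw, ← hadj, ContinuousLinearMap.adjoint_inner_right]

theorem integral_schwartz_mul_eq_inner {g : ℝ → ℂ} {w : L2R} (hw : w =ᵐ[volume] g)
    (ψ : 𝓢(ℝ, ℂ)) :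
    Integrable (fun x => ψ x * g x) ∧ ∫ x : ℝ, ψ x * g x = ⟪star w, ψ.toLp 2 volume⟫_ℂ := by
  refine ⟨((ψ.memLp 2 volume).integrable_mul (Lp.memLp w)).congr ?_, ?_⟩
  · filter_upwards [hw] with x hx
    simp [hx]
  · rw [L2.inner_def]
    refine integral_congr_ae ?_
    filter_upwards [hw, Lp.coeFn_star w, ψ.coeFn_toLp 2 volume] with x h1 h2 h3
    rw [h2, h3]
    simp [h1]

/-- The integral operator maps the conjugate wavelets to the coefficients of any wavelet
representation of its kernel. -/
theorem Op_star_wavelet_eq {φ : ℝ → ℂ} {b : HilbertBasis (ℤ × ℤ) ℂ L2R}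
    (hb : ∀ j n : ℤ, b (j, n) =ᵐ[volume] waveletSystem φ j n) {e : HilbertBasis (ℤ × ℤ) ℂ L2R}
    (he : ∀ i, e i = star (b i)) {k : L2R2} {c : ℤ → ℤ → L2R} {P : ℤ → ℤ → ℕ →₀ L2R}
    (hrep : IsWaveletRepresentation φ (kernelDistribution k) c P)
    (hc : Summable fun i : ℤ × ℤ => ‖c i.1 i.2‖ ^ 2) (i : ℤ × ℤ) : Op k (e i) = c i.1 i.2 := by
  refine apply_hilbertBasis_eq_of_hasSum (Op k) e (fun i => c i.1 i.2) hc
    {d | ∃ ψ : 𝓢(ℝ, ℂ), HasVanishingMoments ψ ∧ ψ.toLp 2 volume = d}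
    (fun u hu => eq_zero_of_forall_inner_vanishingMoments u fun ψ hψ => hu _ ⟨ψ, hψ, rfl⟩) ?_ i
  rintro _ ⟨ψ, hψ, rfl⟩
  refine (hrep ψ).congr_fun fun i => ?_
  have h := integral_schwartz_mul_eq_inner (hb i.1 i.2) ψ
  rw [integral_smul_add_polyFun hψ _ h.1, h.2, he]

/-- The exponent `s + 1/2 - 1/p` is zero, and equal inner and outer exponents merge the two norms
into one. -/
theorem besovSeqNorm_eq_tsum {E : Type*} [NormedAddCommGroup E] [NormedSpace ℂ E]
    [CompleteSpace E] {p : ℝ} (hp0 : 0 < p) (c : ℤ → ℤ → E) :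
    besovSeqNorm (1 / p - 1 / 2) (ENNReal.ofReal p) (ENNReal.ofReal p) c =
      (∑' i : ℤ × ℤ, ‖c i.1 i.2‖ₑ ^ p) ^ (1 / p) := by
  have hp : ENNReal.ofReal p ≠ 0 := by simpa using hp0
  unfold besovSeqNorm
  simp only [eLpNorm_eq_lintegral_rpow_enorm_toReal hp ENNReal.ofReal_ne_top,
    ENNReal.toReal_ofReal hp0.le, lintegral_count, enorm_eq_self]
  congr 1
  rw [ENNReal.tsum_prod', ENNReal.tsum_comm]
  refine tsum_congr fun n => ?_
  rw [show (n : ℝ) * (1 / p - 1 / 2 + 1 / 2 - 1 / p) = 0 by ring, ENNReal.rpow_zero, one_mul,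
    ← ENNReal.rpow_mul, one_div_mul_cancel hp0.ne', ENNReal.rpow_one]

theorem memSchatten_Op_of_representation {p : ℝ} (hp0 : 0 < p) (hp2 : p ≤ 2) {φ : ℝ → ℂ}
    (hφ : IsOrthonormalWavelet φ) {k : L2R2} {c : ℤ → ℤ → L2R} {P : ℤ → ℤ → ℕ →₀ L2R}
    (hrep : IsWaveletRepresentation φ (kernelDistribution k) c P)
    (hfin : besovSeqNorm (1 / p - 1 / 2) (ENNReal.ofReal p) (ENNReal.ofReal p) c < ∞) :
    IsCompactOperator (Op k) ∧ schattenNorm p (Op k) ≤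
      besovSeqNorm (1 / p - 1 / 2) (ENNReal.ofReal p) (ENNReal.ofReal p) c := by
  rw [besovSeqNorm_eq_tsum hp0] at hfin ⊢
  have hsum : ∑' i : ℤ × ℤ, ‖c i.1 i.2‖ₑ ^ p ≠ ∞ :=
    ((ENNReal.rpow_lt_top_iff_of_pos (by positivity)).1 hfin).ne
  have hc := summable_norm_sq_of_tsum_enorm_rpow hp0 hp2 hsum
  obtain ⟨b, hb⟩ := hφ
  obtain ⟨e, he⟩ := exists_conj_hilbertBasis b
  have hOp := Op_star_wavelet_eq hb he hrep hc
  have hs : Summable fun i => ‖Op k (e i)‖ ^ 2 := by simpa only [hOp] using hc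
  refine ⟨isCompactOperator_of_summable e (Op k) hs, ?_⟩
  have h := tsum_singularValue_rpow_le e (Op k) hp0 hp2 hs
  simp only [hOp] at h
  exact ENNReal.rpow_le_rpow h (by positivity)

end Coefficients

theorem mainTheorem1 (p : ℝ) (hp0 : 0 < p) (hp2 : p ≤ 2) :
    ∃ C : ℝ≥0, ∀ (N : ℕ) (_ : |1 / p - 1 / 2| < (N : ℝ)) (φ : ℝ → ℂ) (_ : IsCompactWavelet N φ)
      (k : L2R2),
      MemHomBesov φ (1 / p - 1 / 2) (ENNReal.ofReal p) (ENNReal.ofReal p)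
        (kernelDistribution k) →
      MemSchatten p (Op k) ∧
        schattenNorm p (Op k) ≤
          C * (‖k‖ₑ + homBesovSeminorm φ (1 / p - 1 / 2) (ENNReal.ofReal p) (ENNReal.ofReal p)
            (kernelDistribution k)) := by
  refine ⟨1, fun N _ φ hφ k hk => ⟨?_, ?_⟩⟩
  · obtain ⟨c, P, hrep, hfin⟩ := hk
    have h := memSchatten_Op_of_representation hp0 hp2 hφ.isOrthonormalWavelet hrep hfin
    exact ⟨h.1, h.2.trans_lt hfin⟩
  · rw [ENNReal.coe_one, one_mul]
    refine le_trans ?_ le_add_self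
    refine le_iInf fun c => le_iInf₂ fun P hrep => ?_
    -- The infimum also runs over representations of infinite quasi-norm, for which the bound is
    -- trivial.
    rcases lt_or_ge (besovSeqNorm (1 / p - 1 / 2) (ENNReal.ofReal p) (ENNReal.ofReal p) c) ∞
      with hfin | hfin
    · exact (memSchatten_Op_of_representation hp0 hp2 hφ.isOrthonormalWavelet hrep hfin).2
    · exact le_top.trans hfin
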